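/- Theorem. For an index set we always list the elements in ascending order. For a matrix $A$ and sets $I$, $J$ of row and column indices with $|I|=|J|$, let $[I|J]_A$ denote the minor of $A$ with rows $I$ and columns $J$, with $[\varnothing|\varnothing]_A:=1$. For index sets of the same size, $\{i_1<\dots<i_s\}\le\{i'_1<\dots<i'_s\}$ means $i_k\le i'_k$ for all $k$. A real matrix is totally nonnegative if all of its minors are nonnegative. Let $\boldsymbol r=\{r_1<\dots<r_t\}\subseteq\{1,\dots,m\}$ and $\boldsymbol c=\{c_1<\dots<c_t\}\subseteq\{1,\dots,n\}$ have the same size $t\ge 0$. - $\mathcal M_{\boldsymbol r,\boldsymbol c}$ is the class of $m\times n$ matrices $A$ such that $\operatorname{rank}A=t$; $[r_1,\dots,r_s|c_1,\dots,c_s]_A\ne0$ for each $s\le t$; and $[I|J]_A=0$ whenever $|I|=|J|=s\le t$ and $I\ngeq\{r_1,\dots,r_s\}$ or $J\ngeq\{c_1,\dots,c_s\}$. - $\mathcal L^*_{\boldsymbol r}$ is the class of $m\times t$ matrices $L=(l_{ij})$ such that, for all $j$, $l_{r_jj}=1$ and $l_{ij}=0$ for all $i<r_j$. - $\mathcal U_{\boldsymbol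 c}$ is the class of $t\times n$ matrices $U=(u_{ij})$ such that, for all $i$, $u_{ic_i}\ne0$ and $u_{ij}=0$ for all $j<c_i$. Let $A$ be a real $m\times n$ totally nonnegative matrix. Then there is a unique pair $\boldsymbol r,\boldsymbol c$ (with $|\boldsymbol r|=|\boldsymbol c|$) such that $A\in\mathcal M_{\boldsymbol r,\boldsymbol c}$. For this pair there is a unique pair of real matrices $L\in\mathcal L^*_{\boldsymbol r}$, $U\in\mathcal U_{\boldsymbol c}$ such that $A=LU$. Both $L$ and $U$ are totally nonnegative, and they are given explicitly by $$l_{ij}=[r_1,\dots,r_{j-1},i\,|\,c_1,\dots,c_j]_A\,[r_1,\dots,r_j|c_1,\dots,c_j]_A^{-1}\quad(i\ge r_j),\qquad l_{ij}=0\quad(i<r_j),$$ $$u_{ij}=[r_1,\dots,r_i\,|\,c_1,\dots,c_{i-1},j]_A\,[r_1,\dots,r_{i-1}|c_1,\dots,c_{i-1}]_A^{-1}\quad(j\ge c_i),\qquad u_{ij}=0\quad(j<c_i).$$ -/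

import Mathlib

namespace TNN

/- A `t`-element subset `{r_1 < ⋯ < r_t}` of `{1, …, m}` is encoded by the order embedding
`r : Fin t ↪o Fin m` that lists it in strictly ascending order. -/

/-- The minor `[I|J]_A`, with rows `I 0, …, I (s-1)` and columns `J 0, …, J (s-1)` listed in
ascending order. For `s = 0` it equals `1`. -/
def minor {R : Type*} [CommRing R] {m n s : ℕ} (A : Matrix (Fin m) (Fin n) R)
    (I : Fin s ↪o Fin m) (J : Fin s ↪o Fin n) : R :=
  (A.submatrix I J).det

/-- A real matrix is totally nonnegative if each of its minors is nonnegative. -/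
def IsTotallyNonneg {m n : ℕ} (A : Matrix (Fin m) (Fin n) ℝ) : Prop :=
  ∀ (s : ℕ) (I : Fin s ↪o Fin m) (J : Fin s ↪o Fin n), 0 ≤ minor A I J

/-- The `s` smallest elements `{r_1, …, r_s}` of `{r_1, …, r_t}`, where `s ≤ t`. -/
def initial {m t : ℕ} (r : Fin t ↪o Fin m) (s : ℕ) (hs : s ≤ t) : Fin s ↪o Fin m :=
  (Fin.castLEOrderEmb hs).trans r

/-- The partial order `I ≤ I'` on index sets of the same cardinality: entrywise comparison of the
ascending listings. -/
def IndexLE {m s : ℕ} (I I' : Fin s ↪o Fin m) : Prop :=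
  ∀ k : Fin s, I k ≤ I' k

/-- The class `𝓛_r` of `m × t` matrices. -/
def ClassL {K : Type*} [Field K] {m t : ℕ} (r : Fin t ↪o Fin m) :
    Set (Matrix (Fin m) (Fin t) K) :=
  {L | ∀ j : Fin t, L (r j) j ≠ 0 ∧ ∀ i : Fin m, i < r j → L i j = 0}

/-- The class `𝓛_r^*` of `m × t` matrices. -/
def ClassLStar {K : Type*} [Field K] {m t : ℕ} (r : Fin t ↪o Fin m) :
    Set (Matrix (Fin m) (Fin t) K) :=
  {L | L ∈ ClassL r ∧ ∀ j : Fin t, L (r j) j = 1}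

/-- The class `𝓤_c` of `t × n` matrices. -/
def ClassU {K : Type*} [Field K] {n t : ℕ} (c : Fin t ↪o Fin n) :
    Set (Matrix (Fin t) (Fin n) K) :=
  {U | ∀ i : Fin t, U i (c i) ≠ 0 ∧ ∀ j : Fin n, j < c i → U i j = 0}

/-- The class `𝓜_{r,c}` of `m × n` matrices. -/
structure InClassM {K : Type*} [Field K] {m n t : ℕ} (r : Fin t ↪o Fin m) (c : Fin t ↪o Fin n)
    (A : Matrix (Fin m) (Fin n) K) : Prop where
  rank_eq : A.rank = t
  minor_ne_zero : ∀ (s : ℕ) (hs : s ≤ t), minor A (initial r s hs) (initial c s hs) ≠ 0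
  minor_eq_zero : ∀ (s : ℕ) (hs : s ≤ t) (I : Fin s ↪o Fin m) (J : Fin s ↪o Fin n),
    (¬ IndexLE (initial r s hs) I ∨ ¬ IndexLE (initial c s hs) J) → minor A I J = 0

/-- The `m × t` matrix with `l_{ij} = 0` for `i < r_j` and
`l_{ij} = [r_1,…,r_{j-1},i | c_1,…,c_j]_A / [r_1,…,r_j | c_1,…,c_j]_A` for `i ≥ r_j`.
The index `j : Fin t` is zero-based, so that `initial r j _` lists the `j` elements of
`r` strictly before `r j`. `Fin.snoc` appends `i` at the end, where it belongs in the ascending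
order because `i ≥ r j`. -/
def explicitL {K : Type*} [Field K] {m n t : ℕ} (A : Matrix (Fin m) (Fin n) K)
    (r : Fin t ↪o Fin m) (c : Fin t ↪o Fin n) : Matrix (Fin m) (Fin t) K :=
  fun i j =>
    if i < r j then 0
    else
      (A.submatrix (Fin.snoc (initial r j j.isLt.le) i : Fin (j + 1) → Fin m)
          (initial c (j + 1) j.isLt)).det
        * (minor A (initial r (j + 1) j.isLt) (initial c (j + 1) j.isLt))⁻¹

/-- The `t × n` matrix with `u_{ij} = 0` for `j < c_i` and
`u_{ij} = [r_1,…,r_i | c_1,…,c_{i-1},j]_A / [r_1,…,r_{i-1} | c_1,…,c_{i-1}]_A` for `j ≥ c_i`. -/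
def explicitU {K : Type*} [Field K] {m n t : ℕ} (A : Matrix (Fin m) (Fin n) K)
    (r : Fin t ↪o Fin m) (c : Fin t ↪o Fin n) : Matrix (Fin t) (Fin n) K :=
  fun i j =>
    if j < c i then 0
    else
      (A.submatrix (initial r (i + 1) i.isLt)
          (Fin.snoc (initial c i i.isLt.le) j : Fin (i + 1) → Fin n)).det
        * (minor A (initial r i i.isLt.le) (initial c i i.isLt.le))⁻¹

end TNN

namespace TNN
open Matrix

/-! Existence comes from Neville elimination. In a totally nonnegative matrix, clear the lowest
nonzero entry of the first column by subtracting a multiple of the row directly above. Total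
nonnegativity survives (`IsTotallyNonneg.eliminate`): a changed minor is nonnegative because two
cofactors of a bordered submatrix satisfy `IsTotallyNonneg.mul_minor_le_mul_minor`, an inequality
proved by induction from a three-term Plücker relation. Undoing the operation only adds a
nonnegative multiple of a row of the left factor to the next row. Together with transposition,
deletion of zero rows, and splitting off an isolated corner entry, this yields a factorization with
totally nonnegative echelon factors.

Uniqueness is algebraic. In a product `L * U` of echelon matrices, minors on initial pivot rows or
columns factor into two minors, often triangular ones. This puts `L * U` in the class of `(r, c)`
and recovers every entry of `L` and `U` as a quotient of minors. Rank and antisymmetry of the index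
order determine `r` and `c`. -/

/-! ### Minors along monotone index maps. -/

theorem det_nonneg_of_strictMono {m n s : ℕ} {A : Matrix (Fin m) (Fin n) ℝ}
    (hA : IsTotallyNonneg A) {f : Fin s → Fin m} {g : Fin s → Fin n}
    (hf : StrictMono f) (hg : StrictMono g) : 0 ≤ (A.submatrix f g).det :=
  hA s (OrderEmbedding.ofStrictMono f hf) (OrderEmbedding.ofStrictMono g hg)

/-- A repeated index makes a minor vanish, so monotone maps suffice. The repetition is needed when a
matrix is bordered by a column it may already contain. -/
theorem IsTotallyNonneg.submatrix {m n m' n' : ℕ} {A : Matrix (Fin m) (Fin n) ℝ}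
    (hA : IsTotallyNonneg A) {f : Fin m' → Fin m} {g : Fin n' → Fin n}
    (hf : Monotone f) (hg : Monotone g) : IsTotallyNonneg (A.submatrix f g) := by
  intro s I J
  unfold minor
  rw [Matrix.submatrix_submatrix]
  by_cases h1 : Function.Injective (f ∘ I)
  · by_cases h2 : Function.Injective (g ∘ J)
    · exact det_nonneg_of_strictMono hA ((hf.comp I.monotone).strictMono_of_injective h1)
        ((hg.comp J.monotone).strictMono_of_injective h2)
    · simp only [Function.Injective, not_forall] at h2
      obtain ⟨a, b, hab, hne⟩ := h2
      exact (Matrix.det_zero_of_column_eq hne fun k => congrArg (A (f (I k))) hab).ge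
  · simp only [Function.Injective, not_forall] at h1
    obtain ⟨a, b, hab, hne⟩ := h1
    exact (Matrix.det_zero_of_row_eq hne (funext fun k => congrArg (A · (g (J k))) hab)).ge

theorem IsTotallyNonneg.transpose {m n : ℕ} {A : Matrix (Fin m) (Fin n) ℝ}
    (hA : IsTotallyNonneg A) : IsTotallyNonneg Aᵀ := by
  intro s I J
  unfold minor
  rw [← Matrix.det_transpose]
  exact hA s J I

theorem IsTotallyNonneg.apply_nonneg {m n : ℕ} {A : Matrix (Fin m) (Fin n) ℝ}
    (hA : IsTotallyNonneg A) (i : Fin m) (j : Fin n) : 0 ≤ A i j := by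
  have := det_nonneg_of_strictMono hA (s := 1) (f := fun _ => i) (g := fun _ => j)
    (Subsingleton.strictMono _) (Subsingleton.strictMono _)
  simpa using this

theorem IsTotallyNonneg.mul_le_mul {m n : ℕ} {A : Matrix (Fin m) (Fin n) ℝ}
    (hA : IsTotallyNonneg A) {i i' : Fin m} {j j' : Fin n} (hi : i < i') (hj : j < j') :
    A i j' * A i' j ≤ A i j * A i' j' := by
  have := det_nonneg_of_strictMono hA (f := ![i, i']) (g := ![j, j'])
    (by simpa [Fin.strictMono_iff_lt_succ] using hi)
    (by simpa [Fin.strictMono_iff_lt_succ] using hj)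
  rw [Matrix.det_fin_two] at this
  simpa using this

/-! ### A three-term Plücker relation. -/

/-- The signed maximal minors of a matrix with one more row than columns are a left null vector. -/
theorem sum_alternating_minors_mul {R : Type*} [CommRing R] {s : ℕ}
    (B : Matrix (Fin (s + 1)) (Fin s) R) (l : Fin s) :
    ∑ i : Fin (s + 1), (-1) ^ (i : ℕ) * (B.submatrix i.succAbove id).det * B i l = 0 := by
  -- Repeating column `l` in front gives a zero determinant; its expansion along that new column is
  -- the sum.
  let C : Matrix (Fin (s + 1)) (Fin (s + 1)) R :=
    B.submatrix id (Fin.cons l id : Fin (s + 1) → Fin s)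
  have h : C.det = 0 :=
    Matrix.det_zero_of_column_eq (i := 0) (j := l.succ) (Fin.succ_ne_zero l).symm
      fun k => by simp [C]
  rw [Matrix.det_succ_column_zero] at h
  rw [← h]
  refine Finset.sum_congr rfl fun i _ => ?_
  have : C.submatrix i.succAbove Fin.succ = B.submatrix i.succAbove id := by
    ext a b; simp [C]
  rw [this]
  simp only [C, Matrix.submatrix_apply, Fin.cons_zero, id]
  ring

/-- The rows `0, …, k - 1, x, k + 3, …, s + 2` of an ordered list, where the rows
`k, k + 1, k + 2` are replaced by a single row `x`. -/
def replaceThree {s : ℕ} (k : Fin (s + 1)) (x : Fin (s + 3)) (i : Fin (s + 1)) : Fin (s + 3) :=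
  if i < k then i.castSucc.castSucc else if i = k then x else i.succ.succ

/-- The three-term Plücker relation for three consecutive rows. -/
theorem three_term_plucker {R : Type*} [CommRing R] {s : ℕ}
    (B : Matrix (Fin (s + 3)) (Fin (s + 2)) R) (k : Fin (s + 1)) (g : Fin (s + 1) → Fin (s + 2)) :
    (B.submatrix k.castSucc.castSucc.succAbove id).det *
        (B.submatrix (replaceThree k k.castSucc.castSucc) g).det
      + (B.submatrix k.succ.succ.succAbove id).det *
        (B.submatrix (replaceThree k k.succ.succ) g).det
      = (B.submatrix k.castSucc.succ.succAbove id).det *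
        (B.submatrix (replaceThree k k.castSucc.succ) g).det := by
  set M : Matrix (Fin (s + 1)) (Fin (s + 1)) R :=
    B.submatrix (replaceThree k k.castSucc.castSucc) g with hM
  -- Writing the minor through `cramer` makes it linear in the replaced row, so the null vector
  -- relation applies to it.
  have hv : ∀ i, cramer Mᵀ (fun l => B i (g l)) k = (B.submatrix (replaceThree k i) g).det := by
    intro i
    rw [cramer_transpose_apply]
    congr 1
    ext a b
    by_cases h : a = k
    · subst h; simp [replaceThree]
    · simp [replaceThree, h, hM, Matrix.updateRow_apply]
  have hsum : ∑ i : Fin (s + 3), (-1) ^ (i : ℕ) * (B.submatrix i.succAbove id).det *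
      (B.submatrix (replaceThree k i) g).det = 0 := by
    simp_rw [← hv]
    have : ∑ i : Fin (s + 3), ((-1) ^ (i : ℕ) * (B.submatrix i.succAbove id).det) •
        (fun l => B i (g l)) = 0 := by
      ext l
      simpa [Finset.sum_apply] using sum_alternating_minors_mul B (g l)
    have h2 := congrArg (fun v => cramer Mᵀ v k) this
    simpa [map_sum, Finset.sum_apply] using h2
  -- Any other row `i` already occurs in the list, so inserting it repeats a row.
  have hzero : ∀ i, i ≠ k.castSucc.castSucc → i ≠ k.castSucc.succ → i ≠ k.succ.succ →
      (B.submatrix (replaceThree k i) g).det = 0 := by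
    intro i h1 h2 h3
    simp only [ne_eq, Fin.ext_iff, Fin.val_castSucc, Fin.val_succ] at h1 h2 h3
    obtain ⟨a, ha, hai⟩ : ∃ a : Fin (s + 1), a ≠ k ∧ replaceThree k i a = i := by
      rcases lt_or_gt_of_ne h1 with h | h
      · refine ⟨⟨i, by omega⟩, by simp [Fin.ext_iff]; omega, ?_⟩
        simp [replaceThree, Fin.lt_def, h]
      · refine ⟨⟨i - 2, by omega⟩, by simp [Fin.ext_iff]; omega, ?_⟩
        have e1 : ¬ (i : ℕ) - 2 < k := by omega
        have e2 : ¬ (i : ℕ) - 2 = k := by omega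
        simp [replaceThree, Fin.lt_def, e1, e2, Fin.ext_iff]
        omega
    refine Matrix.det_zero_of_row_eq ha ?_
    ext l
    simp only [Matrix.submatrix_apply, hai]
    simp [replaceThree]
  have hsub : ∑ i : Fin (s + 3), (-1) ^ (i : ℕ) * (B.submatrix i.succAbove id).det *
      (B.submatrix (replaceThree k i) g).det =
      ∑ i ∈ {k.castSucc.castSucc, k.castSucc.succ, k.succ.succ}, (-1) ^ (i : ℕ) *
        (B.submatrix i.succAbove id).det * (B.submatrix (replaceThree k i) g).det := by
    symm
    refine Finset.sum_subset (Finset.subset_univ _) fun i _ hi => ?_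
    simp only [Finset.mem_insert, Finset.mem_singleton, not_or] at hi
    rw [hzero i hi.1 hi.2.1 hi.2.2, mul_zero]
  rw [hsub, Finset.sum_insert (by simp [Fin.ext_iff]; try omega),
    Finset.sum_insert (by simp [Fin.ext_iff]; try omega), Finset.sum_singleton] at hsum
  simp only [Fin.val_castSucc, Fin.val_succ, pow_succ] at hsum
  have hsq : ((-1 : R) ^ (k : ℕ)) * (-1) ^ (k : ℕ) = 1 := by
    rw [← mul_pow]; simp
  linear_combination (-1) ^ (k : ℕ) * hsum - ((B.submatrix k.castSucc.castSucc.succAbove id).det *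
        (B.submatrix (replaceThree k k.castSucc.castSucc) g).det
      + (B.submatrix k.succ.succ.succAbove id).det *
        (B.submatrix (replaceThree k k.succ.succ) g).det
      - (B.submatrix k.castSucc.succ.succAbove id).det *
        (B.submatrix (replaceThree k k.castSucc.succ) g).det) * hsq

/-! ### Comparison of neighbouring cofactors. -/

/-- If the first column of a totally nonnegative matrix vanishes below row `k + 1`, then the
cofactors of the entries in rows `k` and `k + 1` of that column are compared by these entries. -/
theorem IsTotallyNonneg.mul_minor_le_mul_minor {s : ℕ} {C : Matrix (Fin (s + 1)) (Fin (s + 1)) ℝ}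
    (hC : IsTotallyNonneg C) (k : Fin s) (hpos : 0 < C k.castSucc 0)
    (hzero : ∀ i, k.succ < i → C i 0 = 0) :
    C k.succ 0 * (C.submatrix k.succ.succAbove Fin.succ).det ≤
      C k.castSucc 0 * (C.submatrix k.castSucc.succAbove Fin.succ).det := by
  induction s with
  | zero => exact k.elim0
  | succ s ih =>
    cases k using Fin.cases with
    | zero =>
      -- For the top two rows the claim is that `C.det` is nonnegative, expanded along its first
      -- column.
      have h0 := det_nonneg_of_strictMono hC strictMono_id strictMono_id
      rw [Matrix.det_succ_column_zero, Fin.sum_univ_succ, Fin.sum_univ_succ,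
        Finset.sum_eq_zero] at h0
      · simp only [Matrix.submatrix_id_id, Fin.val_zero, Fin.val_succ, pow_zero, zero_add,
          pow_one, add_zero] at h0
        change C (Fin.succ 0) 0 * (C.submatrix (Fin.succ 0).succAbove Fin.succ).det ≤
          C 0 0 * (C.submatrix (Fin.succAbove 0) Fin.succ).det
        linarith
      · intro i _
        have := hzero i.succ.succ (by simp [Fin.lt_def])
        simp [this]
    | succ k =>
      cases s with
      | zero => exact k.elim0
      | succ s =>
      set B : Matrix (Fin (s + 3)) (Fin (s + 2)) ℝ := C.submatrix id Fin.succ with hB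
      have hBn : IsTotallyNonneg B := hC.submatrix monotone_id (Fin.strictMono_succ.monotone)
      have hrow : ∀ i : Fin (s + 3), (C.submatrix i.succAbove Fin.succ) =
        B.submatrix i.succAbove id := fun i => rfl
      have ra : (fun i => k.castSucc.castSucc.succAbove (k.succ.succAbove i)) =
          replaceThree k k.castSucc.succ := by
        ext i
        simp only [replaceThree, Fin.succAbove, Fin.lt_def]
        split_ifs <;> simp [Fin.ext_iff] at * <;> omega
      have rb : (fun i => k.castSucc.castSucc.succAbove (k.castSucc.succAbove i)) =
          replaceThree k k.succ.succ := by
        ext i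
        simp only [replaceThree, Fin.succAbove, Fin.lt_def]
        split_ifs <;> simp [Fin.ext_iff] at * <;> omega
      have ra' : (fun i => k.succ.succ.succAbove (k.castSucc.succAbove i)) =
          replaceThree k k.castSucc.succ := by
        ext i
        simp only [replaceThree, Fin.succAbove, Fin.lt_def]
        split_ifs <;> simp [Fin.ext_iff] at * <;> omega
      have pa : k.castSucc.castSucc.succAbove k.castSucc = k.succ.castSucc := by
        simp [Fin.succAbove]
      have pb : k.castSucc.castSucc.succAbove k.succ = k.succ.succ := by
        simp [Fin.succAbove, Fin.lt_def]
      -- Delete row `k` and one column other than the first: the two compared rows move up by one,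
      -- so the induction hypothesis applies.
      have hIH : ∀ j : Fin (s + 2), C k.succ.succ 0 *
          (B.submatrix (replaceThree k k.castSucc.succ) j.succAbove).det ≤
          C k.succ.castSucc 0 * (B.submatrix (replaceThree k k.succ.succ) j.succAbove).det := by
        intro j
        have hD : IsTotallyNonneg (C.submatrix k.castSucc.castSucc.succAbove j.succ.succAbove) :=
          hC.submatrix (Fin.strictMono_succAbove _).monotone (Fin.strictMono_succAbove _).monotone
        have := ih hD k (by simpa [pa] using hpos) (by
          intro i hi
          simp only [Matrix.submatrix_apply, Fin.succ_succAbove_zero]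
          apply hzero
          rw [← pb]
          exact Fin.strictMono_succAbove _ hi)
        simp only [Matrix.submatrix_apply, Matrix.submatrix_submatrix, pa, pb,
          Fin.succ_succAbove_zero, Function.comp_def, Fin.succ_succAbove_succ, ra, rb] at this
        exact this
      have hXa : 0 ≤ (B.submatrix k.succ.succ.succAbove id).det :=
        det_nonneg_of_strictMono hBn (Fin.strictMono_succAbove _) strictMono_id
      have hXb : 0 ≤ (B.submatrix k.castSucc.succ.succAbove id).det :=
        det_nonneg_of_strictMono hBn (Fin.strictMono_succAbove _) strictMono_id
      have hY : 0 ≤ (B.submatrix k.castSucc.castSucc.succAbove id).det :=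
        det_nonneg_of_strictMono hBn (Fin.strictMono_succAbove _) strictMono_id
      have hmono : ∀ x, k.castSucc.castSucc ≤ x → x ≤ k.succ.succ →
          StrictMono (replaceThree k x) := by
        intro x h1 h2 i j hij
        simp only [Fin.le_def, Fin.lt_def, Fin.val_castSucc, Fin.val_succ] at h1 h2 hij
        simp only [replaceThree, Fin.lt_def, Fin.ext_iff]
        split_ifs <;> simp <;> omega
      rw [hrow, hrow]
      change _ * _ ≤ _ * (B.submatrix k.castSucc.succ.succAbove id).det
      -- These minors serve as the factor to cancel. If all vanish, expanding the left-hand minor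
      -- along row `k` shows that it is zero.
      by_cases hall : ∀ j : Fin (s + 2),
          (B.submatrix (replaceThree k k.castSucc.succ) j.succAbove).det = 0
      · have : (B.submatrix k.succ.succ.succAbove id).det = 0 := by
          rw [Matrix.det_succ_row _ k.castSucc]
          refine Finset.sum_eq_zero fun j _ => ?_
          have h : (B.submatrix k.succ.succ.succAbove id).submatrix k.castSucc.succAbove
              j.succAbove = B.submatrix (replaceThree k k.castSucc.succ) j.succAbove := by
            rw [← ra']; rfl
          rw [h, hall j, mul_zero]
        rw [this, mul_zero]
        exact mul_nonneg hpos.le hXb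
      · push Not at hall
        obtain ⟨j, hj⟩ := hall
        have hva := (det_nonneg_of_strictMono hBn
          (hmono k.castSucc.succ (by simp [Fin.le_def]) (by simp [Fin.le_def]))
          (Fin.strictMono_succAbove j)).lt_of_ne' hj
        have hvp := det_nonneg_of_strictMono hBn
          (hmono k.castSucc.castSucc le_rfl (by simp [Fin.le_def]; omega))
          (Fin.strictMono_succAbove j)
        have h3 := three_term_plucker B k j.succAbove
        refine le_of_mul_le_mul_right ?_ hva
        -- The induction hypothesis bounds the left side by a Plücker term, and the Plücker relation
        -- bounds that term by the right side, since its third term is nonnegative.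
        have h4 := mul_le_mul_of_nonneg_left (hIH j) hXa
        have h5 := mul_nonneg hpos.le (mul_nonneg hY hvp)
        linear_combination h4 + h5 + C k.succ.castSucc 0 * h3

/-! ### Elementary operations on adjacent rows. -/

/-- Add `a` times row `k` to the following row. -/
def addToNextRow {m n : ℕ} (A : Matrix (Fin (m + 1)) (Fin n) ℝ) (k : Fin m) (a : ℝ) :
    Matrix (Fin (m + 1)) (Fin n) ℝ :=
  A.updateRow k.succ (A k.succ + a • A k.castSucc)

theorem addToNextRow_addToNextRow_neg {m n : ℕ} (A : Matrix (Fin (m + 1)) (Fin n) ℝ) (k : Fin m)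
    (a : ℝ) : addToNextRow (addToNextRow A k (-a)) k a = A := by
  ext i j
  by_cases h : i = k.succ
  · subst h
    simp [addToNextRow, Matrix.updateRow_apply, Fin.ext_iff]
  · simp [addToNextRow, h]

theorem addToNextRow_mul {m n t : ℕ} (L : Matrix (Fin (m + 1)) (Fin t) ℝ)
    (U : Matrix (Fin t) (Fin n) ℝ) (k : Fin m) (a : ℝ) :
    addToNextRow L k a * U = addToNextRow (L * U) k a := by
  rw [addToNextRow, Matrix.updateRow_mul, addToNextRow, Matrix.add_vecMul, Matrix.smul_vecMul]
  rfl

/-- Only minors containing row `k + 1` but not row `k` can change. There multilinearity gives a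
second minor, in which `k` takes the place of `k + 1`. -/
theorem det_submatrix_addToNextRow {m n s : ℕ} (A : Matrix (Fin (m + 1)) (Fin n) ℝ) (k : Fin m)
    (a : ℝ) {f : Fin s → Fin (m + 1)} (hf : StrictMono f) (g : Fin s → Fin n) :
    ((addToNextRow A k a).submatrix f g).det = (A.submatrix f g).det ∨
    ∃ u, f u = k.succ ∧ (∀ v, f v ≠ k.castSucc) ∧
      ((addToNextRow A k a).submatrix f g).det = (A.submatrix f g).det +
        a * (A.submatrix (Function.update f u k.castSucc) g).det := by
  by_cases h1 : ∃ u, f u = k.succ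
  · obtain ⟨u, hu⟩ := h1
    have e : (addToNextRow A k a).submatrix f g = (A.submatrix f g).updateRow u
        (A.submatrix f g u + a • fun j => A k.castSucc (g j)) := by
      ext i j
      by_cases h : i = u
      · subst h
        simp [addToNextRow, hu]
      · have : f i ≠ k.succ := fun h' => h (hf.injective (h'.trans hu.symm))
        simp [addToNextRow, h, this]
    by_cases h2 : ∃ v, f v = k.castSucc
    · obtain ⟨v, hv⟩ := h2
      left
      have huv : u ≠ v := by
        rintro rfl
        simp [hu, Fin.ext_iff] at hv
      rw [e, ← det_updateRow_add_smul_self (A.submatrix f g) huv a]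
      congr 3
      ext j
      simp [hv]
    · right
      refine ⟨u, hu, fun v hv => h2 ⟨v, hv⟩, ?_⟩
      rw [e, det_updateRow_add, det_updateRow_smul, updateRow_eq_self]
      congr 3
      ext i j
      by_cases h : i = u
      · subst h; simp
      · simp [h]
  · left
    congr 1
    ext i j
    have : f i ≠ k.succ := fun h => h1 ⟨i, h⟩
    simp [addToNextRow, this]

theorem strictMono_update_castSucc {m s : ℕ} {k : Fin m} {f : Fin s → Fin (m + 1)}
    (hf : StrictMono f) {u : Fin s} (hu : f u = k.succ) (hk : ∀ v, f v ≠ k.castSucc) :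
    StrictMono (Function.update f u k.castSucc) := by
  intro i j hij
  have h := hf hij
  have hi := hk i
  by_cases h1 : i = u
  · subst h1
    have h2 : j ≠ i := hij.ne'
    rw [Function.update_self, Function.update_of_ne h2]
    rw [hu] at h
    exact (Fin.castSucc_lt_succ).trans h
  · rw [Function.update_of_ne h1]
    by_cases h2 : j = u
    · subst h2
      rw [Function.update_self]
      simp only [hu, Fin.lt_def, Fin.val_succ, Fin.val_castSucc, ne_eq, Fin.ext_iff] at *
      omega
    · rwa [Function.update_of_ne h2]

theorem IsTotallyNonneg.addToNextRow {m n : ℕ} {A : Matrix (Fin (m + 1)) (Fin n) ℝ}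
    (hA : IsTotallyNonneg A) (k : Fin m) {a : ℝ} (ha : 0 ≤ a) :
    IsTotallyNonneg (addToNextRow A k a) := by
  intro s I J
  have h0 := hA s I J
  unfold minor at h0 ⊢
  rcases det_submatrix_addToNextRow A k a I.strictMono J with h | ⟨u, hu, hk, h⟩
  · rwa [h]
  · rw [h]
    exact add_nonneg h0 (mul_nonneg ha (det_nonneg_of_strictMono hA
      (strictMono_update_castSucc I.strictMono hu hk) J.strictMono))

/-- Border a changed minor by row `k` and column `0`. Deleting column `0` and then row `k` or row `k
+ 1` gives the two minors in the new determinant, so the cofactor comparison is exactly its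
nonnegativity. -/
theorem IsTotallyNonneg.eliminate {m n : ℕ} {A : Matrix (Fin (m + 1)) (Fin (n + 1)) ℝ}
    (hA : IsTotallyNonneg A) (k : Fin m) (hpos : 0 < A k.castSucc 0)
    (hzero : ∀ i, k.succ < i → A i 0 = 0) :
    IsTotallyNonneg (TNN.addToNextRow A k (-(A k.succ 0 / A k.castSucc 0))) := by
  intro s I J
  have h0 := hA s I J
  unfold minor at h0 ⊢
  rcases det_submatrix_addToNextRow A k (-(A k.succ 0 / A k.castSucc 0)) I.strictMono J with
    h | ⟨u, hu, hk, h⟩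
  · rwa [h]
  rw [h]
  have hf : Monotone (u.castSucc.insertNth (α := fun _ => Fin (m + 1)) k.castSucc I) := by
    intro i j hij
    rcases hij.eq_or_lt with rfl | hij
    · rfl
    cases i using Fin.succAboveCases u.castSucc with
    | x =>
      cases j using Fin.succAboveCases u.castSucc with
      | x => simp
      | p j =>
        rw [Fin.insertNth_apply_same, Fin.insertNth_apply_succAbove]
        have : u ≤ j := by
          by_contra hc
          rw [Fin.succAbove_of_castSucc_lt _ _ (by simpa using hc)] at hij
          simp only [Fin.lt_def, Fin.le_def, Fin.val_castSucc] at hc hij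
          omega
        exact (Fin.castSucc_lt_succ).le.trans (hu ▸ I.monotone this)
    | p i =>
      cases j using Fin.succAboveCases u.castSucc with
      | x =>
        rw [Fin.insertNth_apply_same, Fin.insertNth_apply_succAbove]
        have : i < u := by
          by_contra hc
          rw [Fin.succAbove_of_le_castSucc _ _ (by simpa using hc)] at hij
          simp only [Fin.lt_def, Fin.val_castSucc, Fin.val_succ] at hc hij
          omega
        have := I.strictMono this
        rw [hu] at this
        simp only [Fin.lt_def, Fin.le_def, Fin.val_castSucc, Fin.val_succ] at this ⊢
        omega
      | p j =>
        rw [Fin.insertNth_apply_succAbove, Fin.insertNth_apply_succAbove]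
        exact I.monotone ((Fin.strictMono_succAbove _).lt_iff_lt.1 hij).le
  have hg : Monotone (Fin.cons 0 J : Fin (s + 1) → Fin (n + 1)) := by
    intro i j hij
    cases i using Fin.cases with
    | zero => simp
    | succ i =>
      cases j using Fin.cases with
      | zero => simp at hij
      | succ j => simpa using hij
  have hC := hA.submatrix hf hg
  have ha : u.castSucc.insertNth (α := fun _ => Fin (m + 1)) k.castSucc I u.succ = k.succ := by
    rw [← Fin.succAbove_castSucc_self, Fin.insertNth_apply_succAbove, hu]
  have key := hC.mul_minor_le_mul_minor u (by simpa using hpos) (by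
    intro i hi
    obtain ⟨i, rfl⟩ := Fin.exists_succAbove_eq
      (x := i) (y := u.castSucc) (by rintro rfl; simp [Fin.lt_def] at hi)
    have : u < i := by
      by_contra hc
      have h2 := hi
      simp only [Fin.succAbove, Fin.lt_def, Fin.val_castSucc, Fin.val_succ] at h2 hc
      split_ifs at h2 <;> simp at h2 <;> omega
    simp only [Matrix.submatrix_apply, Fin.insertNth_apply_succAbove, Fin.cons_zero]
    exact hzero _ (hu ▸ I.strictMono this))
  simp only [Matrix.submatrix_apply, ha, Fin.insertNth_apply_same, Fin.cons_zero,
    Matrix.submatrix_submatrix] at key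
  have e1 : (u.castSucc.insertNth (α := fun _ => Fin (m + 1)) k.castSucc I) ∘
      u.castSucc.succAbove = I := by
    ext i; simp
  have e2 : (u.castSucc.insertNth (α := fun _ => Fin (m + 1)) k.castSucc I) ∘
      u.succ.succAbove = Function.update I u k.castSucc := by
    funext i
    rcases lt_trichotomy i u with hi | rfl | hi
    · have : u.succ.succAbove i = u.castSucc.succAbove i := by
        simp only [Fin.succAbove, Fin.lt_def, Fin.val_castSucc, Fin.val_succ, Fin.ext_iff] at *
        split_ifs <;> first | rfl | (simp; omega)
      simp [this, hi.ne]
    · simp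
    · have : u.succ.succAbove i = u.castSucc.succAbove i := by
        simp only [Fin.succAbove, Fin.lt_def, Fin.val_castSucc, Fin.val_succ, Fin.ext_iff] at *
        split_ifs <;> simp <;> omega
      simp [this, hi.ne']
  have e3 : (Fin.cons 0 J : Fin (s + 1) → Fin (n + 1)) ∘ Fin.succ = J := by
    ext i; simp
  rw [e1, e2, e3] at key
  have : 0 ≤ (A k.castSucc 0)⁻¹ * (A k.castSucc 0 * (A.submatrix I J).det -
      A k.succ 0 * (A.submatrix (Function.update I u k.castSucc) J).det) :=
    mul_nonneg (inv_nonneg.2 hpos.le) (sub_nonneg.2 key)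
  rw [mul_sub, inv_mul_cancel_left₀ hpos.ne'] at this
  linear_combination this

/-! ### Operations preserving the existence of a factorization. -/

/-- `A` is a product of totally nonnegative matrices in echelon form. -/
def HasTNFactorization {m n : ℕ} (A : Matrix (Fin m) (Fin n) ℝ) : Prop :=
  ∃ (t : ℕ) (r : Fin t ↪o Fin m) (c : Fin t ↪o Fin n) (L : Matrix (Fin m) (Fin t) ℝ)
    (U : Matrix (Fin t) (Fin n) ℝ), L ∈ ClassL r ∧ U ∈ ClassU c ∧ IsTotallyNonneg L ∧
      IsTotallyNonneg U ∧ A = L * U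

/-- With no pivots normalized, the two echelon classes are exchanged by transposition. -/
theorem HasTNFactorization.of_transpose {m n : ℕ} {A : Matrix (Fin m) (Fin n) ℝ}
    (h : HasTNFactorization Aᵀ) : HasTNFactorization A := by
  obtain ⟨t, r, c, L, U, hL, hU, hLn, hUn, hA⟩ := h
  refine ⟨t, c, r, Uᵀ, Lᵀ, hU, hL, hUn.transpose, hLn.transpose, ?_⟩
  rw [← Matrix.transpose_mul, ← hA, Matrix.transpose_transpose]

theorem hasTNFactorization_zero {m n : ℕ} :
    HasTNFactorization (0 : Matrix (Fin m) (Fin n) ℝ) := by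
  refine ⟨0, OrderEmbedding.ofIsEmpty, OrderEmbedding.ofIsEmpty, 0, 0, fun j => j.elim0,
    fun j => j.elim0, ?_, ?_, by simp⟩
  · intro s I J
    cases s with
    | zero => simp [minor]
    | succ s => exact (J 0).elim0
  · intro s I J
    cases s with
    | zero => simp [minor]
    | succ s => exact (I 0).elim0

/-- Insert a zero row at position `p`. -/
def insertZeroRow {m n : ℕ} (p : Fin (m + 1)) (A : Matrix (Fin m) (Fin n) ℝ) :
    Matrix (Fin (m + 1)) (Fin n) ℝ :=
  fun i j => p.insertNth (α := fun _ => ℝ) 0 (fun i => A i j) i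

@[simp] theorem insertZeroRow_same {m n : ℕ} (p : Fin (m + 1)) (A : Matrix (Fin m) (Fin n) ℝ)
    (j : Fin n) : insertZeroRow p A p j = 0 := by
  simp [insertZeroRow]

@[simp] theorem insertZeroRow_succAbove {m n : ℕ} (p : Fin (m + 1)) (A : Matrix (Fin m) (Fin n) ℝ)
    (i : Fin m) (j : Fin n) : insertZeroRow p A (p.succAbove i) j = A i j := by
  simp [insertZeroRow]

theorem IsTotallyNonneg.insertZeroRow {m n : ℕ} {A : Matrix (Fin m) (Fin n) ℝ}
    (hA : IsTotallyNonneg A) (p : Fin (m + 1)) : IsTotallyNonneg (insertZeroRow p A) := by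
  intro s I J
  unfold minor
  by_cases h : ∃ i, I i = p
  · obtain ⟨i, hi⟩ := h
    exact (Matrix.det_eq_zero_of_row_eq_zero i fun j => by simp [hi]).ge
  · push Not at h
    choose f hf using fun i => Fin.exists_succAbove_eq (h i)
    have hfm : StrictMono f := fun a b hab => by
      rw [← (Fin.strictMono_succAbove p).lt_iff_lt, hf, hf]
      exact I.strictMono hab
    convert det_nonneg_of_strictMono hA hfm J.strictMono using 2
    ext i j
    simp [← hf]

theorem HasTNFactorization.of_row_eq_zero {m n : ℕ} {A : Matrix (Fin (m + 1)) (Fin n) ℝ}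
    {p : Fin (m + 1)} (hp : A p = 0) (h : HasTNFactorization (A.submatrix p.succAbove id)) :
    HasTNFactorization A := by
  obtain ⟨t, r, c, L, U, hL, hU, hLn, hUn, hA⟩ := h
  refine ⟨t, r.trans (Fin.succAboveOrderEmb p), c, TNN.insertZeroRow p L, U,
    fun j => ⟨?_, fun i hi => ?_⟩, hU, hLn.insertZeroRow p, hUn, ?_⟩
  · simpa using (hL j).1
  · cases i using Fin.succAboveCases p with
    | x => simp
    | p i =>
      rw [insertZeroRow_succAbove]
      exact (hL j).2 i ((Fin.strictMono_succAbove p).lt_iff_lt.1 hi)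
  · ext i j
    cases i using Fin.succAboveCases p with
    | x => simp [hp, Matrix.mul_apply]
    | p i =>
      have := congrFun (congrFun hA i) j
      simpa [Matrix.mul_apply] using this

/-- Above a pivot the column of `L` is zero, so adding a row to the one below changes no pivot and
creates no entry above one. -/
theorem HasTNFactorization.addToNextRow {m n : ℕ} {A : Matrix (Fin (m + 1)) (Fin n) ℝ}
    (h : HasTNFactorization A) (k : Fin m) {a : ℝ} (ha : 0 ≤ a) :
    HasTNFactorization (addToNextRow A k a) := by
  obtain ⟨t, r, c, L, U, hL, hU, hLn, hUn, hA⟩ := h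
  refine ⟨t, r, c, TNN.addToNextRow L k a, U, fun j => ⟨?_, fun i hi => ?_⟩, hU,
    hLn.addToNextRow k ha, hUn, by rw [addToNextRow_mul, hA]⟩
  · by_cases h : r j = k.succ
    · have h0 : L k.castSucc j = 0 := (hL j).2 _ (h ▸ Fin.castSucc_lt_succ)
      have := (hL j).1
      rw [h] at this
      simpa [TNN.addToNextRow, h, h0] using this
    · simpa [TNN.addToNextRow, h] using (hL j).1
  · have h0 := (hL j).2 i hi
    by_cases h : i = k.succ
    · subst h
      have h1 : L k.castSucc j = 0 := (hL j).2 _ (Fin.castSucc_lt_succ.trans hi)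
      simp [TNN.addToNextRow, h0, h1]
    · simpa [TNN.addToNextRow, h] using h0

/-- The block diagonal matrix with diagonal blocks `a` and `A`. -/
def consDiag {m n : ℕ} (a : ℝ) (A : Matrix (Fin m) (Fin n) ℝ) :
    Matrix (Fin (m + 1)) (Fin (n + 1)) ℝ :=
  fun i j => Fin.cases (Fin.cases a (fun _ => 0) j) (fun i => Fin.cases 0 (fun j => A i j) j) i

@[simp] theorem consDiag_zero_zero {m n : ℕ} (a : ℝ) (A : Matrix (Fin m) (Fin n) ℝ) :
    consDiag a A 0 0 = a := rfl

@[simp] theorem consDiag_zero_succ {m n : ℕ} (a : ℝ) (A : Matrix (Fin m) (Fin n) ℝ) (j : Fin n) :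
    consDiag a A 0 j.succ = 0 := rfl

@[simp] theorem consDiag_succ_zero {m n : ℕ} (a : ℝ) (A : Matrix (Fin m) (Fin n) ℝ) (i : Fin m) :
    consDiag a A i.succ 0 = 0 := rfl

@[simp] theorem consDiag_succ_succ {m n : ℕ} (a : ℝ) (A : Matrix (Fin m) (Fin n) ℝ) (i : Fin m)
    (j : Fin n) : consDiag a A i.succ j.succ = A i j := rfl

theorem consDiag_mul {m n t : ℕ} (a b : ℝ) (L : Matrix (Fin m) (Fin t) ℝ)
    (U : Matrix (Fin t) (Fin n) ℝ) :
    consDiag a L * consDiag b U = consDiag (a * b) (L * U) := by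
  ext i j
  cases i using Fin.cases <;> cases j using Fin.cases <;>
    simp [Matrix.mul_apply, Fin.sum_univ_succ]

theorem exists_succ_comp {m s : ℕ} {f : Fin s → Fin (m + 1)} (hf : StrictMono f)
    (h : ∀ i, f i ≠ 0) : ∃ g : Fin s → Fin m, StrictMono g ∧ ∀ i, f i = (g i).succ := by
  refine ⟨fun i => (f i).pred (h i), fun i j hij => ?_, fun i => by simp⟩
  simpa using hf hij

theorem IsTotallyNonneg.consDiag {m n : ℕ} {A : Matrix (Fin m) (Fin n) ℝ}
    (hA : IsTotallyNonneg A) {a : ℝ} (ha : 0 ≤ a) : IsTotallyNonneg (consDiag a A) := by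
  intro s I J
  unfold minor
  by_cases hI : ∃ i, I i = 0
  · by_cases hJ : ∃ j, J j = 0
    · obtain ⟨i, hi⟩ := hI
      obtain ⟨j, hj⟩ := hJ
      cases s with
      | zero => exact i.elim0
      | succ s =>
        have hI0 : I 0 = 0 := le_antisymm (hi ▸ I.monotone (Fin.zero_le i)) (Fin.zero_le _)
        have hJ0 : J 0 = 0 := le_antisymm (hj ▸ J.monotone (Fin.zero_le j)) (Fin.zero_le _)
        obtain ⟨f, hf, hIf⟩ := exists_succ_comp (I.strictMono.comp Fin.strictMono_succ)
          fun i => (Fin.pos_iff_ne_zero.1 (hI0 ▸ I.strictMono (Fin.succ_pos i)))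
        obtain ⟨g, hg, hJg⟩ := exists_succ_comp (J.strictMono.comp Fin.strictMono_succ)
          fun i => (Fin.pos_iff_ne_zero.1 (hJ0 ▸ J.strictMono (Fin.succ_pos i)))
        simp only [Function.comp_apply] at hIf hJg
        rw [Matrix.det_succ_column_zero, Fin.sum_univ_succ, Finset.sum_eq_zero]
        · have e : ((TNN.consDiag a A).submatrix I J).submatrix (Fin.succAbove 0) Fin.succ =
              A.submatrix f g := by
            ext i j
            simp [hIf, hJg]
          rw [e]
          simpa [hI0, hJ0] using mul_nonneg ha (det_nonneg_of_strictMono hA hf hg)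
        · intro i _
          simp [hIf, hJ0]
    · push Not at hJ
      obtain ⟨i, hi⟩ := hI
      obtain ⟨g, -, hJg⟩ := exists_succ_comp J.strictMono hJ
      exact (Matrix.det_eq_zero_of_row_eq_zero i fun j => by simp [hi, hJg]).ge
  · push Not at hI
    obtain ⟨f, hf, hIf⟩ := exists_succ_comp I.strictMono hI
    by_cases hJ : ∃ j, J j = 0
    · obtain ⟨j, hj⟩ := hJ
      exact (Matrix.det_eq_zero_of_column_eq_zero j fun i => by simp [hj, hIf]).ge
    · push Not at hJ
      obtain ⟨g, hg, hJg⟩ := exists_succ_comp J.strictMono hJ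
      convert det_nonneg_of_strictMono hA hf hg using 2
      ext i j
      simp [hIf, hJg]

/-- Prepend a new smallest element to an index set. -/
def consZero {m t : ℕ} (r : Fin t ↪o Fin m) : Fin (t + 1) ↪o Fin (m + 1) :=
  OrderEmbedding.ofStrictMono (Fin.cons 0 fun j => (r j).succ) <| by
    intro i j hij
    cases j using Fin.cases with
    | zero => simp at hij
    | succ j => cases i using Fin.cases <;> simp_all

@[simp] theorem consZero_zero {m t : ℕ} (r : Fin t ↪o Fin m) : consZero r 0 = 0 := rfl

@[simp] theorem consZero_succ {m t : ℕ} (r : Fin t ↪o Fin m) (j : Fin t) :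
    consZero r j.succ = (r j).succ := rfl

theorem consDiag_mem_classL {m t : ℕ} {r : Fin t ↪o Fin m} {L : Matrix (Fin m) (Fin t) ℝ}
    (hL : L ∈ ClassL r) {a : ℝ} (ha : a ≠ 0) : consDiag a L ∈ ClassL (consZero r) := by
  intro j
  cases j using Fin.cases with
  | zero => exact ⟨by simpa using ha, fun i hi => by simp at hi⟩
  | succ j =>
    refine ⟨by simpa using (hL j).1, fun i hi => ?_⟩
    cases i using Fin.cases with
    | zero => simp
    | succ i => simpa using (hL j).2 i (by simpa using hi)

theorem consDiag_mem_classU {n t : ℕ} {c : Fin t ↪o Fin n} {U : Matrix (Fin t) (Fin n) ℝ}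
    (hU : U ∈ ClassU c) {a : ℝ} (ha : a ≠ 0) : consDiag a U ∈ ClassU (consZero c) := by
  intro i
  cases i using Fin.cases with
  | zero => exact ⟨by simpa using ha, fun i hi => by simp at hi⟩
  | succ i =>
    refine ⟨by simpa using (hU i).1, fun j hj => ?_⟩
    cases j using Fin.cases with
    | zero => simp
    | succ j => simpa using (hU i).2 j (by simpa using hj)

theorem HasTNFactorization.consDiag {m n : ℕ} {A : Matrix (Fin m) (Fin n) ℝ}
    (h : HasTNFactorization A) {a : ℝ} (ha : 0 < a) : HasTNFactorization (consDiag a A) := by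
  obtain ⟨t, r, c, L, U, hL, hU, hLn, hUn, hA⟩ := h
  exact ⟨t + 1, consZero r, consZero c, TNN.consDiag 1 L, TNN.consDiag a U,
    consDiag_mem_classL hL one_ne_zero, consDiag_mem_classU hU ha.ne',
    hLn.consDiag zero_le_one, hUn.consDiag ha.le, by rw [consDiag_mul, one_mul, hA]⟩

/-! ### Neville elimination and the induction. -/

/-- The number of nonzero entries in the first column plus the number of nonzero entries in the
first row. -/
noncomputable def borderSupport {m n : ℕ} (A : Matrix (Fin (m + 1)) (Fin (n + 1)) ℝ) : ℕ :=
  {i | A i 0 ≠ 0}.ncard + {j | A 0 j ≠ 0}.ncard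

theorem borderSupport_transpose {m n : ℕ} (A : Matrix (Fin (m + 1)) (Fin (n + 1)) ℝ) :
    borderSupport Aᵀ = borderSupport A := add_comm _ _

/-- One step of Neville elimination. -/
theorem IsTotallyNonneg.exists_elimination {m n : ℕ} {A : Matrix (Fin (m + 1)) (Fin (n + 1)) ℝ}
    (hA : IsTotallyNonneg A) (hrow : ∀ i, A i ≠ 0) (hk : ∃ k : Fin m, A k.succ 0 ≠ 0) :
    ∃ B : Matrix (Fin (m + 1)) (Fin (n + 1)) ℝ, IsTotallyNonneg B ∧
      borderSupport B < borderSupport A ∧ (HasTNFactorization B → HasTNFactorization A) := by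
  obtain ⟨k, hk, hmax⟩ : ∃ k : Fin m, A k.succ 0 ≠ 0 ∧ ∀ l, k < l → A l.succ 0 = 0 := by
    have hfin := Set.toFinite {k : Fin m | A k.succ 0 ≠ 0}
    obtain ⟨k, hk, hmax⟩ := hfin.exists_maximal hk
    exact ⟨k, hk, fun l hl => by_contra fun h => (hmax (y := l) h hl.le).not_gt hl⟩
  have hkpos : 0 < A k.succ 0 := (hA.apply_nonneg _ _).lt_of_ne' hk
  -- Were this entry zero, a nonzero entry elsewhere in row `k` would give a negative `2 × 2` minor
  -- with the entry below.
  have hpos : 0 < A k.castSucc 0 := by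
    refine (hA.apply_nonneg _ _).lt_of_ne' fun h0 => ?_
    obtain ⟨j, hj⟩ := Function.ne_iff.1 (hrow k.castSucc)
    have hj0 : 0 < j := Fin.pos_iff_ne_zero.2 (by rintro rfl; exact hj h0)
    have := hA.mul_le_mul (Fin.castSucc_lt_succ (i := k)) hj0
    rw [h0, zero_mul] at this
    exact this.not_gt (mul_pos ((hA.apply_nonneg _ _).lt_of_ne' hj) hkpos)
  refine ⟨_, hA.eliminate k hpos fun i hi => ?_, ?_, fun h => ?_⟩
  · cases i using Fin.cases with
    | zero => simp at hi
    | succ i => exact hmax i (by simpa using hi)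
  · have hcol : {i | TNN.addToNextRow A k (-(A k.succ 0 / A k.castSucc 0)) i 0 ≠ 0} =
        {i | A i 0 ≠ 0} \ {k.succ} := by
      ext i
      by_cases h : i = k.succ
      · subst h
        simp [TNN.addToNextRow, hpos.ne']
      · simp [TNN.addToNextRow, h]
    have hrow0 : {j | TNN.addToNextRow A k (-(A k.succ 0 / A k.castSucc 0)) 0 j ≠ 0} =
        {j | A 0 j ≠ 0} := by
      ext j
      simp [TNN.addToNextRow, Matrix.updateRow_apply, (Fin.succ_ne_zero k).symm]
    unfold borderSupport
    rw [hcol, hrow0]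
    exact Nat.add_lt_add_right (Set.ncard_sdiff_singleton_lt_of_mem hk (Set.toFinite _)) _
  · rw [← addToNextRow_addToNextRow_neg A k (A k.succ 0 / A k.castSucc 0)]
    exact h.addToNextRow k (div_nonneg hkpos.le hpos.le)

/-- Induction on the border support at fixed `m + n`. Both dimensions stay quantified so that the
hypothesis also covers transposes. Zero rows or columns reduce the size; otherwise elimination
shrinks the border until only the corner is left, which splits off. -/
theorem HasTNFactorization.of_smaller {N : ℕ}
    (ih : ∀ (m n : ℕ) (A : Matrix (Fin m) (Fin n) ℝ), m + n < N → IsTotallyNonneg A →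
      HasTNFactorization A) (d : ℕ) :
    ∀ (m n : ℕ) (A : Matrix (Fin (m + 1)) (Fin (n + 1)) ℝ), m + 1 + (n + 1) = N →
      borderSupport A = d → IsTotallyNonneg A → HasTNFactorization A := by
  induction d using Nat.strong_induction_on with
  | _ d ihd =>
  have hzero : ∀ (m n : ℕ) (A : Matrix (Fin (m + 1)) (Fin (n + 1)) ℝ), m + 1 + (n + 1) = N →
      IsTotallyNonneg A → (∃ i, A i = 0) → HasTNFactorization A := by
    rintro m n A hN hA ⟨i, hi⟩
    exact .of_row_eq_zero hi (ih _ _ _ (by omega)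
      (hA.submatrix (Fin.strictMono_succAbove i).monotone monotone_id))
  have hstep : ∀ (m n : ℕ) (A : Matrix (Fin (m + 1)) (Fin (n + 1)) ℝ), m + 1 + (n + 1) = N →
      borderSupport A = d → IsTotallyNonneg A → (∀ i, A i ≠ 0) → (∃ k : Fin m, A k.succ 0 ≠ 0) →
      HasTNFactorization A := by
    intro m n A hN hd hA hrow hk
    obtain ⟨B, hB, hlt, h⟩ := hA.exists_elimination hrow hk
    exact h (ihd _ (hd ▸ hlt) m n B hN rfl hB)
  intro m n A hN hd hA
  by_cases hrow : ∃ i, A i = 0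
  · exact hzero m n A hN hA hrow
  by_cases hcol : ∃ j, Aᵀ j = 0
  · exact (hzero n m Aᵀ (by omega) hA.transpose hcol).of_transpose
  push Not at hrow hcol
  by_cases hk : ∃ k : Fin m, A k.succ 0 ≠ 0
  · exact hstep m n A hN hd hA hrow hk
  by_cases hl : ∃ l : Fin n, A 0 l.succ ≠ 0
  · exact (hstep n m Aᵀ (by omega) (by rw [borderSupport_transpose, hd]) hA.transpose hcol
      hl).of_transpose
  push Not at hk hl
  have h00 : A 0 0 ≠ 0 := by
    intro h
    refine hrow 0 (funext fun j => ?_)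
    cases j using Fin.cases with
    | zero => exact h
    | succ j => exact hl j
  have e : A = TNN.consDiag (A 0 0) (A.submatrix Fin.succ Fin.succ) := by
    ext i j
    cases i using Fin.cases <;> cases j using Fin.cases <;> simp [hk, hl]
  rw [e]
  exact (ih _ _ _ (by omega) (hA.submatrix Fin.strictMono_succ.monotone
    Fin.strictMono_succ.monotone)).consDiag ((hA.apply_nonneg 0 0).lt_of_ne' h00)

theorem IsTotallyNonneg.hasTNFactorization {m n : ℕ} {A : Matrix (Fin m) (Fin n) ℝ}
    (hA : IsTotallyNonneg A) : HasTNFactorization A := by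
  induction hN : m + n using Nat.strong_induction_on generalizing m n with
  | _ N ih =>
  rcases m with _ | m
  · rw [Subsingleton.elim A 0]
    exact hasTNFactorization_zero
  rcases n with _ | n
  · rw [Subsingleton.elim A 0]
    exact hasTNFactorization_zero
  exact .of_smaller (fun m n A hlt hA => ih _ hlt hA rfl) _ m n A hN rfl hA

/-! ### Minors of products of echelon matrices. -/

section Field

variable {K : Type*} [Field K] {m n t s : ℕ} {r : Fin t ↪o Fin m} {c : Fin t ↪o Fin n}
  {L : Matrix (Fin m) (Fin t) K} {U : Matrix (Fin t) (Fin n) K}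

theorem initial_apply (r : Fin t ↪o Fin m) (hs : s ≤ t) (q : Fin s) :
    initial r s hs q = r (Fin.castLE hs q) := rfl

theorem transpose_mem_classU (hL : L ∈ ClassL r) : Lᵀ ∈ ClassU r := hL

theorem transpose_mem_classL (hU : U ∈ ClassU c) : Uᵀ ∈ ClassL c := hU

theorem classU_apply_eq_zero (hU : U ∈ ClassU c) {p q : Fin t} (h : p < q) : U q (c p) = 0 :=
  (hU q).2 _ (c.strictMono h)

/-- Every column but the last is a pivot column, so the submatrix is upper triangular whatever the
last column is. -/
theorem det_submatrix_of_mem_classU (hU : U ∈ ClassU c) (hs : s ≤ t) {g : Fin s → Fin n}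
    (hg : ∀ p q : Fin s, p < q → g p = c (Fin.castLE hs p)) :
    (U.submatrix (Fin.castLE hs) g).det = ∏ q, U (Fin.castLE hs q) (g q) := by
  rw [Matrix.det_of_isUpperTriangular]
  · rfl
  · intro q p hpq
    rw [Matrix.submatrix_apply, hg p q hpq]
    exact classU_apply_eq_zero hU hpq

theorem det_submatrix_of_mem_classL (hL : L ∈ ClassL r) (hs : s ≤ t) {f : Fin s → Fin m}
    (hf : ∀ p q : Fin s, p < q → f p = r (Fin.castLE hs p)) :
    (L.submatrix f (Fin.castLE hs)).det = ∏ q, L (f q) (Fin.castLE hs q) := by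
  rw [← Matrix.det_transpose]
  exact det_submatrix_of_mem_classU (transpose_mem_classU hL) hs hf

theorem det_submatrix_initial_of_mem_classU (hU : U ∈ ClassU c) (hs : s ≤ t) :
    (U.submatrix (Fin.castLE hs) (initial c s hs)).det =
      ∏ q : Fin s, U (Fin.castLE hs q) (c (Fin.castLE hs q)) :=
  det_submatrix_of_mem_classU hU hs fun _ _ _ => rfl

theorem det_submatrix_initial_of_mem_classL (hL : L ∈ ClassL r) (hs : s ≤ t) :
    (L.submatrix (initial r s hs) (Fin.castLE hs)).det =
      ∏ q : Fin s, L (r (Fin.castLE hs q)) (Fin.castLE hs q) :=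
  det_submatrix_of_mem_classL hL hs fun _ _ _ => rfl

/-- The first `s` pivot columns of `U` vanish below its first `s` rows, so the sum over the inner
index stops at `s`. -/
theorem mul_submatrix_initial_right (hU : U ∈ ClassU c) (hs : s ≤ t) {l : Type*} (f : l → Fin m) :
    (L * U).submatrix f (initial c s hs) =
      L.submatrix f (Fin.castLE hs) * U.submatrix (Fin.castLE hs) (initial c s hs) := by
  ext a b
  simp only [Matrix.submatrix_apply, Matrix.mul_apply]
  refine (Fintype.sum_of_injective (Fin.castLE hs) (Fin.castLE_injective hs) _ _
    (fun q hq => ?_) fun _ => rfl).symm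
  rw [initial_apply, classU_apply_eq_zero hU, mul_zero]
  by_contra h
  exact hq ⟨⟨q, lt_of_le_of_lt (not_lt.1 h) b.isLt⟩, rfl⟩

theorem mul_submatrix_initial_left (hL : L ∈ ClassL r) (hs : s ≤ t) {l : Type*} (g : l → Fin n) :
    (L * U).submatrix (initial r s hs) g =
      L.submatrix (initial r s hs) (Fin.castLE hs) * U.submatrix (Fin.castLE hs) g := by
  have := mul_submatrix_initial_right (L := Uᵀ) (transpose_mem_classU hL) hs g
  rw [← Matrix.transpose_mul, ← Matrix.transpose_submatrix, ← Matrix.transpose_submatrix,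
    ← Matrix.transpose_submatrix, ← Matrix.transpose_mul] at this
  exact Matrix.transpose_injective this

theorem minor_initial_mul (hL : L ∈ ClassL r) (hU : U ∈ ClassU c) (hs : s ≤ t) :
    minor (L * U) (initial r s hs) (initial c s hs) =
      (∏ q : Fin s, L (r (Fin.castLE hs q)) (Fin.castLE hs q)) *
        ∏ q : Fin s, U (Fin.castLE hs q) (c (Fin.castLE hs q)) := by
  rw [minor, mul_submatrix_initial_right hU, Matrix.det_mul,
    det_submatrix_initial_of_mem_classL hL, det_submatrix_initial_of_mem_classU hU]

/-- If `I k < r k`, the `k + 1` rows `I 0, …, I k` of `L` are supported in the first `k` columns,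
hence dependent; the dependence carries over to `L * U`. -/
theorem minor_mul_eq_zero_of_not_indexLE (hL : L ∈ ClassL r) (hs : s ≤ t) {I : Fin s ↪o Fin m}
    {J : Fin s ↪o Fin n} (hI : ¬ IndexLE (initial r s hs) I) : minor (L * U) I J = 0 := by
  simp only [IndexLE, not_forall, not_le, initial_apply] at hI
  obtain ⟨k, hk⟩ := hI
  have hks : (k : ℕ) + 1 ≤ s := k.isLt
  have hzero : ∀ (a : Fin (k + 1)) (q : Fin t), Fin.castLE hs k ≤ q →
      L (I (Fin.castLE hks a)) q = 0 := fun a q hq =>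
    (hL q).2 _ ((I.monotone (Nat.lt_succ_iff.1 a.isLt)).trans_lt
      (hk.trans_le (r.monotone hq)))
  -- One zero column is included to make the matrix square, so that a null vector comes from its
  -- determinant.
  have hdet : (L.submatrix (fun a : Fin (k + 1) => I (Fin.castLE hks a))
      (Fin.castLE (hks.trans hs))).det = 0 :=
    Matrix.det_eq_zero_of_column_eq_zero (Fin.last k) fun a => hzero a _ le_rfl
  obtain ⟨v, hv0, hv⟩ := Matrix.exists_vecMul_eq_zero_iff.2 hdet
  have hw : Function.extend (Fin.castLE hks) v 0 ᵥ* L.submatrix I id = 0 := by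
    ext q
    simp only [Matrix.vecMul, dotProduct, Matrix.submatrix_apply, id, Pi.zero_apply]
    rw [← Fintype.sum_of_injective (Fin.castLE hks) (Fin.castLE_injective hks)
      (fun a => v a * L (I (Fin.castLE hks a)) q) _
      (fun i hi => by rw [Function.extend_apply' _ _ _ hi]; simp)
      (fun a => by rw [(Fin.castLE_injective hks).extend_apply])]
    by_cases hq : q ≤ Fin.castLE hs k
    · exact congrFun hv ⟨q, Nat.lt_succ_iff.2 hq⟩
    · exact Finset.sum_eq_zero fun a _ => by rw [hzero a q (not_le.1 hq).le, mul_zero]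
  rw [minor, ← Matrix.exists_vecMul_eq_zero_iff]
  refine ⟨Function.extend (Fin.castLE hks) v 0, fun h => hv0 ?_, ?_⟩
  · ext a
    rw [← (Fin.castLE_injective hks).extend_apply v 0 a, h]
    rfl
  · rw [Matrix.submatrix_mul L U I id J Function.bijective_id, ← Matrix.vecMul_vecMul, hw,
      Matrix.zero_vecMul]

theorem inClassM_mul (hL : L ∈ ClassL r) (hU : U ∈ ClassU c) : InClassM r c (L * U) := by
  have hne : ∀ (s : ℕ) (hs : s ≤ t), minor (L * U) (initial r s hs) (initial c s hs) ≠ 0 := by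
    intro s hs
    rw [minor_initial_mul hL hU]
    exact mul_ne_zero (Finset.prod_ne_zero_iff.2 fun q _ => (hL _).1)
      (Finset.prod_ne_zero_iff.2 fun q _ => (hU _).1)
  refine ⟨le_antisymm ((Matrix.rank_mul_le_left L U).trans L.rank_le_width) ?_, hne, ?_⟩
  · have := Matrix.rank_of_det_ne_zero (hne t le_rfl)
    rw [Fintype.card_fin] at this
    exact this.symm.le.trans (Matrix.rank_submatrix_le _ _ _)
  · rintro s hs I J (h | h)
    · exact minor_mul_eq_zero_of_not_indexLE hL hs h
    · rw [minor, ← Matrix.det_transpose, Matrix.transpose_submatrix, Matrix.transpose_mul]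
      exact minor_mul_eq_zero_of_not_indexLE (transpose_mem_classL hU) hs h

/-- Numerator and denominator share the same nonzero minor of `U`. What remains is a triangular
minor of `L` with unit diagonal except for the entry `L i j`. -/
theorem eq_explicitL (hL : L ∈ ClassLStar r) (hU : U ∈ ClassU c) : L = explicitL (L * U) r c := by
  ext i j
  unfold explicitL
  split_ifs with h
  · exact (hL.1 j).2 i h
  · have hPU : ∏ q : Fin (j + 1), U (Fin.castLE j.isLt q) (c (Fin.castLE j.isLt q)) ≠ 0 :=
      Finset.prod_ne_zero_iff.2 fun q _ => (hU _).1
    rw [minor_initial_mul hL.1 hU, mul_submatrix_initial_right hU, Matrix.det_mul,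
      det_submatrix_initial_of_mem_classU hU, det_submatrix_of_mem_classL hL.1]
    · simp only [initial_apply, hL.2, Finset.prod_const_one, one_mul, Fin.prod_univ_castSucc,
        Fin.snoc_castSucc, Fin.snoc_last] at hPU ⊢
      have e : ∀ q : Fin j, L (r (Fin.castLE j.isLt.le q)) (Fin.castLE j.isLt q.castSucc) = 1 :=
        fun q => hL.2 _
      simp only [e, Finset.prod_const_one, one_mul]
      rw [mul_assoc, mul_inv_cancel₀ hPU, mul_one]
      rfl
    · intro p q hpq
      obtain ⟨p, rfl⟩ := Fin.exists_castSucc_eq.2 (Fin.ne_last_of_lt hpq)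
      rw [Fin.snoc_castSucc]
      rfl

theorem eq_explicitU (hL : L ∈ ClassLStar r) (hU : U ∈ ClassU c) : U = explicitU (L * U) r c := by
  ext i j
  unfold explicitU
  split_ifs with h
  · exact (hU i).2 j h
  · have hPU : ∏ q : Fin i, U (Fin.castLE i.isLt.le q) (c (Fin.castLE i.isLt.le q)) ≠ 0 :=
      Finset.prod_ne_zero_iff.2 fun q _ => (hU _).1
    rw [minor_initial_mul hL.1 hU, mul_submatrix_initial_left hL.1, Matrix.det_mul,
      det_submatrix_initial_of_mem_classL hL.1, det_submatrix_of_mem_classU hU]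
    · simp only [hL.2, Finset.prod_const_one, one_mul]
      rw [Fin.prod_univ_castSucc]
      simp only [Fin.snoc_castSucc, Fin.snoc_last]
      exact (mul_inv_cancel_left₀ hPU _).symm.trans (by rw [mul_right_comm, mul_assoc]; rfl)
    · intro p q hpq
      obtain ⟨p, rfl⟩ := Fin.exists_castSucc_eq.2 (Fin.ne_last_of_lt hpq)
      rw [Fin.snoc_castSucc]
      rfl

/-- Otherwise the vanishing condition for `(r, c)` would kill the full pivot minor of `(r', c')`. -/
theorem InClassM.indexLE {A : Matrix (Fin m) (Fin n) K} {r' : Fin t ↪o Fin m} {c' : Fin t ↪o Fin n}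
    (h : InClassM r c A) (h' : InClassM r' c' A) : (∀ k, r k ≤ r' k) ∧ ∀ k, c k ≤ c' k := by
  by_contra hc
  refine h'.minor_ne_zero t le_rfl (h.minor_eq_zero t le_rfl _ _ ?_)
  exact not_and_or.1 hc

theorem InClassM.unique {A : Matrix (Fin m) (Fin n) K} {t' : ℕ} {r' : Fin t' ↪o Fin m}
    {c' : Fin t' ↪o Fin n} (h : InClassM r c A) (h' : InClassM r' c' A) :
    (⟨t, r, c⟩ : Σ t : ℕ, (Fin t ↪o Fin m) × (Fin t ↪o Fin n)) = ⟨t', r', c'⟩ := by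
  obtain rfl : t = t' := h.rank_eq.symm.trans h'.rank_eq
  obtain rfl : r = r' :=
    RelEmbedding.ext fun k => le_antisymm ((h.indexLE h').1 k) ((h'.indexLE h).1 k)
  obtain rfl : c = c' :=
    RelEmbedding.ext fun k => le_antisymm ((h.indexLE h').2 k) ((h'.indexLE h).2 k)
  rfl

end Field

/-! ### Normalization of pivots and conclusion. -/

theorem IsTotallyNonneg.mul_diagonal {m n : ℕ} {A : Matrix (Fin m) (Fin n) ℝ}
    (hA : IsTotallyNonneg A) {d : Fin n → ℝ} (hd : ∀ j, 0 ≤ d j) :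
    IsTotallyNonneg (A * diagonal d) := by
  intro s I J
  have e : (A * diagonal d).submatrix I J = A.submatrix I J * diagonal (d ∘ J) := by
    ext i j
    simp [Matrix.mul_diagonal]
  rw [minor, e, Matrix.det_mul, Matrix.det_diagonal]
  exact mul_nonneg (hA s I J) (Finset.prod_nonneg fun j _ => hd _)

/-- A totally nonnegative matrix has a totally nonnegative factorization with normalized pivots in
the left factor. -/
theorem IsTotallyNonneg.exists_normalized_factorization {m n : ℕ} {A : Matrix (Fin m) (Fin n) ℝ}
    (hA : IsTotallyNonneg A) :
    ∃ (t : ℕ) (r : Fin t ↪o Fin m) (c : Fin t ↪o Fin n) (L : Matrix (Fin m) (Fin t) ℝ)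
      (U : Matrix (Fin t) (Fin n) ℝ), L ∈ ClassLStar r ∧ U ∈ ClassU c ∧ IsTotallyNonneg L ∧
        IsTotallyNonneg U ∧ A = L * U := by
  obtain ⟨t, r, c, L, U, hL, hU, hLn, hUn, rfl⟩ := hA.hasTNFactorization
  have hpos : ∀ j, 0 < L (r j) j := fun j => (hLn.apply_nonneg _ _).lt_of_ne' (hL j).1
  -- The positive pivots of `L` are moved into `U` by a diagonal matrix and its inverse.
  refine ⟨t, r, c, L * diagonal fun j => (L (r j) j)⁻¹, diagonal (fun j => L (r j) j) * U,
    ⟨fun j => ⟨?_, fun i hi => ?_⟩, fun j => ?_⟩, fun i => ⟨?_, fun j hj => ?_⟩,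
    hLn.mul_diagonal fun j => (inv_pos.2 (hpos j)).le, ?_, ?_⟩
  · simp [Matrix.mul_diagonal, (hL j).1]
  · simp [Matrix.mul_diagonal, (hL j).2 i hi]
  · simp [Matrix.mul_diagonal, (hL j).1]
  · simp [(hL i).1, (hU i).1]
  · simp [(hU i).2 j hj]
  · have := (hUn.transpose.mul_diagonal fun j => (hpos j).le).transpose
    simpa [Matrix.transpose_mul] using this
  · have e : (diagonal fun j => (L (r j) j)⁻¹) * diagonal (fun j => L (r j) j) = 1 := by
      rw [Matrix.diagonal_mul_diagonal, ← Matrix.diagonal_one]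
      congr 1
      ext j
      exact inv_mul_cancel₀ (hL j).1
    rw [Matrix.mul_assoc, ← Matrix.mul_assoc (diagonal _) (diagonal _), e, Matrix.one_mul]

end TNN

theorem mainTheorem1 (m n : ℕ) (A : Matrix (Fin m) (Fin n) ℝ) (hA : TNN.IsTotallyNonneg A) :
    (∃! p : Σ t : ℕ, (Fin t ↪o Fin m) × (Fin t ↪o Fin n), TNN.InClassM p.2.1 p.2.2 A) ∧
    ∀ (t : ℕ) (r : Fin t ↪o Fin m) (c : Fin t ↪o Fin n), TNN.InClassM r c A →
      (∃! P : Matrix (Fin m) (Fin t) ℝ × Matrix (Fin t) (Fin n) ℝ,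
        P.1 ∈ TNN.ClassLStar r ∧ P.2 ∈ TNN.ClassU c ∧ A = P.1 * P.2) ∧
      ∀ (L : Matrix (Fin m) (Fin t) ℝ) (U : Matrix (Fin t) (Fin n) ℝ),
        L ∈ TNN.ClassLStar r → U ∈ TNN.ClassU c → A = L * U →
          TNN.IsTotallyNonneg L ∧ TNN.IsTotallyNonneg U ∧
          L = TNN.explicitL A r c ∧ U = TNN.explicitU A r c := by
  obtain ⟨t₀, r₀, c₀, L₀, U₀, hL₀, hU₀, hL₀n, hU₀n, hA₀⟩ := hA.exists_normalized_factorization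
  have hM : TNN.InClassM r₀ c₀ A := hA₀ ▸ TNN.inClassM_mul hL₀.1 hU₀
  refine ⟨⟨⟨t₀, r₀, c₀⟩, hM, fun p hp => TNN.InClassM.unique hp hM⟩, ?_⟩
  intro t r c h
  -- Any admissible index data equal those of the constructed factorization, so the explicit
  -- formulas identify every factorization with that one.
  obtain ⟨rfl, hrc⟩ := Sigma.mk.inj (TNN.InClassM.unique hM h)
  obtain ⟨rfl, rfl⟩ := Prod.mk.inj (eq_of_heq hrc)
  have hexpl : ∀ (L : Matrix (Fin m) (Fin t₀) ℝ) (U : Matrix (Fin t₀) (Fin n) ℝ),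
      L ∈ TNN.ClassLStar r₀ → U ∈ TNN.ClassU c₀ → A = L * U →
        L = TNN.explicitL A r₀ c₀ ∧ U = TNN.explicitU A r₀ c₀ := by
    rintro L U hL hU rfl
    exact ⟨TNN.eq_explicitL hL hU, TNN.eq_explicitU hL hU⟩
  obtain ⟨hL₀e, hU₀e⟩ := hexpl L₀ U₀ hL₀ hU₀ hA₀
  refine ⟨⟨(L₀, U₀), ⟨hL₀, hU₀, hA₀⟩, ?_⟩, ?_⟩
  · rintro ⟨L, U⟩ ⟨hL, hU, hLU⟩
    obtain ⟨hLe, hUe⟩ := hexpl L U hL hU hLU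
    exact Prod.ext (hLe.trans hL₀e.symm) (hUe.trans hU₀e.symm)
  · intro L U hL hU hLU
    obtain ⟨hLe, hUe⟩ := hexpl L U hL hU hLU
    exact ⟨hLe.trans hL₀e.symm ▸ hL₀n, hUe.trans hU₀e.symm ▸ hU₀n, hLe, hUe⟩
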